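/- Let $m,n\ge 1$, let $n_0=\min\{m,n\}$, and for a complex $m\times n$ matrix $X$ let $\sigma_1(X)\ge\sigma_2(X)\ge\cdots\ge\sigma_{n_0}(X)\ge 0$ be its singular values, with the convention $\sigma_i(X)=0$ for $i>n_0$. For $1\le p<\infty$ and $1\le k\le n_0$, the Ky Fan $p$-$k$ norm is $$\|X\|_{(p,k)}=\bigl(\sigma_1(X)^p+\cdots+\sigma_k(X)^p\bigr)^{1/p}.$$ Let $\mathcal M$ be a (real or complex) linear subspace of $\mathbb M_{m\times n}(\mathbb C)$ and let $A\in\mathbb M_{m\times n}(\mathbb C)$. A matrix $B\in\mathcal M$ is a best approximation of $A$ with respect to $\|\cdot\|_{(p,k)}$ if $\|A-B\|_{(p,k)}=\min_{X\in\mathcal M}\|A-X\|_{(p,k)}$; let $\mathcal W^{(p,k)}$ be the set of all residuals $R=A-B$, where $B$ runs over these best approximations. **Theorem.** Let $2\le p<\infty$ and $1\le k\le n_0$. Suppose that there is $R_0\in\mathcal W^{(p,k)}$ with $\sigma_k(R_0)>\sigma_{k+1}(R_0)$. Then for every $R\in\mathcal W^{(p,k)}$ and every $1\le i\le k$, $$\sigma_i(R_0)=\sigma_i(R).$$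 -/

import Mathlib

noncomputable section

namespace KyFanApprox

/-- The `i`-th singular value `σ_i(A)` of a complex matrix, counted from `i = 1` in non-increasing
order with multiplicity. `LinearMap.singularValues` is indexed from `0`, and it is `0` beyond the
size of `A`, so that `σ_i(A) = 0` for `i > min m n`. -/
def singularValue {m n : ℕ} (A : Matrix (Fin m) (Fin n) ℂ) (i : ℕ) : ℝ :=
  (Matrix.toEuclideanLin A).singularValues (i - 1)

/-- The Ky Fan `p`-`k` norm `(σ_1(A)^p + ⋯ + σ_k(A)^p)^(1/p)`. -/
def kyFanNorm {m n : ℕ} (p : ℝ) (k : ℕ) (A : Matrix (Fin m) (Fin n) ℂ) : ℝ :=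
  (∑ i ∈ Finset.Icc 1 k, singularValue A i ^ p) ^ (1 / p)

/-- `B` is a best approximation of `A` in the subspace `M` with respect to the Ky Fan `p`-`k`
norm. The scalars of `M` are real, so that real and complex subspaces are both covered. -/
def IsBestApprox {m n : ℕ} (p : ℝ) (k : ℕ) (M : Submodule ℝ (Matrix (Fin m) (Fin n) ℂ))
    (A B : Matrix (Fin m) (Fin n) ℂ) : Prop :=
  B ∈ M ∧ ∀ X ∈ M, kyFanNorm p k (A - B) ≤ kyFanNorm p k (A - X)

/-- The set of all residuals `A - B` with `B` a best approximation of `A` in `M`. -/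
def residuals {m n : ℕ} (p : ℝ) (k : ℕ) (M : Submodule ℝ (Matrix (Fin m) (Fin n) ℂ))
    (A : Matrix (Fin m) (Fin n) ℂ) : Set (Matrix (Fin m) (Fin n) ℂ) :=
  {R | ∃ B, IsBestApprox p k M A B ∧ R = A - B}

end KyFanApprox

end

/-!
Any two residuals agree in their first `k` singular values because the midpoint `S` of two residuals
`R₀`, `R` is again a candidate, so it cannot have a smaller Ky Fan norm than either of them, and
the comparison of the three norms is rigid when `p ≥ 2`.

Let `v₁, …, v_k` be the first `k` right singular vectors of `S`, so that `‖S vᵢ‖ = σᵢ(S)`. The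
parallelogram law and convexity of `t ↦ t ^ (p / 2)` give
`(‖S vᵢ‖² + ‖(R₀ - S) vᵢ‖²) ^ (p / 2) ≤ (‖R₀ vᵢ‖ ^ p + ‖R vᵢ‖ ^ p) / 2`
(`rpow_norm_sq_add_norm_sq_midpoint_le`). Summed over `i`, the right-hand side is at most the mean of
the `p`-th powers of the norms of `R₀` and `R`, since `∑ ‖T vᵢ‖ ^ p ≤ ∑ σᵢ(T) ^ p` for orthonormal
`v₁, …, v_k` (`LinearMap.sum_norm_apply_rpow_le`), and this mean is at most `∑ ‖S vᵢ‖ ^ p`. Hence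
`R₀ vᵢ = S vᵢ` for all `i ≤ k` (`LinearMap.apply_rightSingularBasis_eq_of_midpoint`).

Consequently `R₀` stretches the span of `v₁, …, vᵢ` at least by `σᵢ(S)`, and the Courant–Fischer
principle yields `σᵢ(S) ≤ σᵢ(R₀)` for `i ≤ k`. As the norm of `R₀` is at most that of `S`, all these
inequalities are equalities; the same holds for `R`.

Singular values of linear maps are indexed from `0` below, those of matrices from `1`.
-/

open Module InnerProductSpace

/-! ### Inequalities for weighted sums and powers -/

theorem Real.sq_rpow_div_two {t : ℝ} (ht : 0 ≤ t) (p : ℝ) : (t ^ 2) ^ (p / 2) = t ^ p := by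
  rw [← Real.rpow_natCast_mul ht]
  congr 1
  push_cast
  ring

/-- A sum of a non-increasing sequence with weights in `[0, 1]` of total mass `k` is at most the
sum of its first `k` terms. -/
theorem Antitone.sum_mul_le_sum_range {s w : ℕ → ℝ} (hs : Antitone s) {k N : ℕ}
    (hkN : k ≤ N) (hw0 : ∀ j, 0 ≤ w j) (hw1 : ∀ j, w j ≤ 1)
    (hw : ∑ j ∈ Finset.range N, w j = k) :
    ∑ j ∈ Finset.range N, w j * s j ≤ ∑ j ∈ Finset.range k, s j := by
  have h1 : ∑ j ∈ Finset.range N, w j * s j =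
      ∑ j ∈ Finset.range N, w j * (s j - s k) + k * s k := by
    rw [← hw, Finset.sum_mul, ← Finset.sum_add_distrib]
    exact Finset.sum_congr rfl fun j _ => by ring
  have h2 : ∑ j ∈ Finset.range k, s j = ∑ j ∈ Finset.range k, (s j - s k) + k * s k := by
    simp
  rw [h1, h2, ← Finset.sum_range_add_sum_Ico _ hkN]
  have h3 : ∑ j ∈ Finset.range k, w j * (s j - s k) ≤ ∑ j ∈ Finset.range k, (s j - s k) :=
    Finset.sum_le_sum fun j hj => mul_le_of_le_one_left
      (sub_nonneg.2 (hs (Finset.mem_range.1 hj).le)) (hw1 j)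
  have h4 : ∑ j ∈ Finset.Ico k N, w j * (s j - s k) ≤ 0 :=
    Finset.sum_nonpos fun j hj => mul_nonpos_of_nonneg_of_nonpos (hw0 j)
      (sub_nonpos.2 (hs (Finset.mem_Ico.1 hj).1))
  linarith

/-- A quantitative form of convexity of `x ↦ ‖x‖ ^ p` for `p ≥ 2`: at the midpoint `s` of `x` and
`y`, the square `‖s‖ ^ 2` may be increased by `‖(x - y) / 2‖ ^ 2 = ‖x - s‖ ^ 2`. -/
theorem rpow_norm_sq_add_norm_sq_midpoint_le (𝕜 : Type*) {F : Type*} [RCLike 𝕜]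
    [NormedAddCommGroup F] [InnerProductSpace 𝕜 F] {x y s : F} {p : ℝ} (hp : 2 ≤ p)
    (hs : x + y = s + s) :
    (‖s‖ ^ 2 + ‖x - s‖ ^ 2) ^ (p / 2) ≤ (‖x‖ ^ p + ‖y‖ ^ p) / 2 := by
  have hpar : ‖s‖ ^ 2 + ‖x - s‖ ^ 2 = 1 / 2 * ‖x‖ ^ 2 + 1 / 2 * ‖y‖ ^ 2 := by
    have h := parallelogram_law_with_norm 𝕜 s (x - s)
    have hy : s - (x - s) = y := by
      rw [sub_sub_eq_add_sub, ← hs, add_sub_cancel_left]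
    rw [add_sub_cancel, hy] at h
    linarith
  have h := (convexOn_rpow (p := p / 2) (by linarith)).2
    (Set.mem_Ici.2 (sq_nonneg ‖x‖)) (Set.mem_Ici.2 (sq_nonneg ‖y‖))
    (one_half_pos (α := ℝ)).le (one_half_pos (α := ℝ)).le (add_halves 1)
  simp only [smul_eq_mul, Real.sq_rpow_div_two (norm_nonneg _)] at h
  rw [hpar]
  linarith

namespace LinearMap

variable {𝕜 E F : Type*} [RCLike 𝕜]
  [NormedAddCommGroup E] [InnerProductSpace 𝕜 E] [FiniteDimensional 𝕜 E]
  [NormedAddCommGroup F] [InnerProductSpace 𝕜 F] [FiniteDimensional 𝕜 F]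

/-! ### Right singular vectors -/

/-- An orthonormal basis of right singular vectors of `T`: the eigenvectors of `T* T`, ordered by
non-increasing eigenvalue, so that the `j`-th vector belongs to `T.singularValues j`. -/
noncomputable def rightSingularBasis (T : E →ₗ[𝕜] F) : OrthonormalBasis (Fin (finrank 𝕜 E)) 𝕜 E :=
  T.isSymmetric_adjoint_comp_self.eigenvectorBasis rfl

theorem norm_apply_sq_eq_sum (T : E →ₗ[𝕜] F) (x : E) :
    ‖T x‖ ^ 2 =
      ∑ j : Fin (finrank 𝕜 E), T.singularValues j ^ 2 * ‖⟪T.rightSingularBasis j, x⟫_𝕜‖ ^ 2 := by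
  have hcoord (j : Fin (finrank 𝕜 E)) : ⟪T.rightSingularBasis j, (adjoint T ∘ₗ T) x⟫_𝕜 =
      ((T.singularValues j ^ 2 : ℝ) : 𝕜) * ⟪T.rightSingularBasis j, x⟫_𝕜 := by
    rw [T.sq_singularValues_fin rfl, ← OrthonormalBasis.repr_apply_apply,
      ← OrthonormalBasis.repr_apply_apply]
    exact T.isSymmetric_adjoint_comp_self.eigenvectorBasis_apply_self_apply rfl x j
  have key : ((‖T x‖ ^ 2 : ℝ) : 𝕜) =
      ((∑ j : Fin (finrank 𝕜 E),
        T.singularValues j ^ 2 * ‖⟪T.rightSingularBasis j, x⟫_𝕜‖ ^ 2 : ℝ) : 𝕜) := by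
    calc ((‖T x‖ ^ 2 : ℝ) : 𝕜) = ⟪x, (adjoint T ∘ₗ T) x⟫_𝕜 := by
          rw [comp_apply, adjoint_inner_right, inner_self_eq_norm_sq_to_K]; push_cast; rfl
      _ = _ := by
          rw [← T.rightSingularBasis.sum_inner_mul_inner x, RCLike.ofReal_sum]
          refine Finset.sum_congr rfl fun j _ => ?_
          rw [hcoord, ← inner_conj_symm x (T.rightSingularBasis j), mul_left_comm,
            RCLike.conj_mul, RCLike.ofReal_mul, RCLike.ofReal_pow (‖_‖)]
  exact_mod_cast key

theorem norm_apply_rightSingularBasis (T : E →ₗ[𝕜] F) (j : Fin (finrank 𝕜 E)) :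
    ‖T (T.rightSingularBasis j)‖ = T.singularValues j := by
  have h : ‖T (T.rightSingularBasis j)‖ ^ 2 = T.singularValues j ^ 2 := by
    rw [norm_apply_sq_eq_sum, Finset.sum_eq_single j]
    · simp
    · intro i _ hij
      simp [T.rightSingularBasis.inner_eq_zero hij]
    · simp
  exact (sq_eq_sq₀ (norm_nonneg _) (T.singularValues_nonneg _)).1 h

/-! ### Comparison of singular values -/

/-- The Courant–Fischer lower bound. The subspace `V` is too large to avoid the orthogonal
complement of the first `i` right singular vectors, on which `T` stretches by at most its `i`-th
singular value. -/
theorem le_singularValues_of_forall_mem (T : E →ₗ[𝕜] F) {i : ℕ} {c : ℝ} (V : Submodule 𝕜 E)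
    (hV : i < finrank 𝕜 V) (hc : ∀ x ∈ V, c * ‖x‖ ≤ ‖T x‖) : c ≤ T.singularValues i := by
  have hi : i ≤ finrank 𝕜 E := hV.le.trans V.finrank_le
  let f : V →ₗ[𝕜] (Fin i → 𝕜) :=
    LinearMap.pi fun j => (innerₛₗ 𝕜 (T.rightSingularBasis (Fin.castLE hi j))) ∘ₗ V.subtype
  obtain ⟨x, hxf, hx0⟩ := (Submodule.ne_bot_iff _).1
    (ker_ne_bot_of_finrank_lt (f := f) (by simpa using hV))
  have hx : ∀ j : Fin (finrank 𝕜 E), (j : ℕ) < i → ⟪T.rightSingularBasis j, (x : E)⟫_𝕜 = 0 :=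
    fun j hj => congrFun (mem_ker.1 hxf) ⟨j, hj⟩
  have hxpos : 0 < ‖(x : E)‖ := norm_pos_iff.2 (by simpa using hx0)
  have hup : ‖T x‖ ≤ T.singularValues i * ‖(x : E)‖ := by
    refine le_of_sq_le_sq ?_ (mul_nonneg (T.singularValues_nonneg i) hxpos.le)
    rw [mul_pow, norm_apply_sq_eq_sum, ← T.rightSingularBasis.sum_sq_norm_inner_right (x : E),
      Finset.mul_sum]
    refine Finset.sum_le_sum fun j _ => ?_
    rcases lt_or_ge (j : ℕ) i with hj | hj
    · simp [hx j hj]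
    · gcongr
      · exact T.singularValues_nonneg _
      · exact T.singularValues_antitone hj
  exact le_of_mul_le_mul_right ((hc x x.2).trans hup) hxpos

theorem singularValues_le_of_eq_on_rightSingularBasis {S T : E →ₗ[𝕜] F} {i : ℕ}
    (hi : i < finrank 𝕜 E)
    (h : ∀ j : Fin (finrank 𝕜 E), (j : ℕ) ≤ i →
      T (S.rightSingularBasis j) = S (S.rightSingularBasis j)) :
    S.singularValues i ≤ T.singularValues i := by
  let v : Fin (i + 1) → E := fun j => S.rightSingularBasis (Fin.castLE hi j)
  have hv : Orthonormal 𝕜 v :=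
    S.rightSingularBasis.orthonormal.comp _ (Fin.castLE_injective hi)
  refine T.le_singularValues_of_forall_mem (Submodule.span 𝕜 (Set.range v)) ?_ fun x hx => ?_
  · rw [finrank_span_eq_card hv.linearIndependent]
    simp
  have hTS : T x = S x := by
    refine LinearMap.eqOn_span (f := T) (g := S) ?_ hx
    rintro _ ⟨j, rfl⟩
    exact h _ (by simpa using Nat.lt_succ_iff.1 j.2)
  have hx0 : ∀ j : Fin (finrank 𝕜 E), i < j → ⟪S.rightSingularBasis j, x⟫_𝕜 = 0 := by
    intro j hj
    have hle : Submodule.span 𝕜 (Set.range v) ≤ ker (innerₛₗ 𝕜 (S.rightSingularBasis j)) := by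
      rw [Submodule.span_le]
      rintro _ ⟨l, rfl⟩
      refine S.rightSingularBasis.inner_eq_zero fun hjl => ?_
      have := congrArg Fin.val hjl
      simp only [Fin.val_castLE] at this
      omega
    exact hle hx
  rw [hTS]
  refine le_of_sq_le_sq ?_ (norm_nonneg _)
  rw [mul_pow, norm_apply_sq_eq_sum, ← S.rightSingularBasis.sum_sq_norm_inner_right x,
    Finset.mul_sum]
  refine Finset.sum_le_sum fun j _ => ?_
  rcases lt_or_ge i (j : ℕ) with hj | hj
  · simp [hx0 j hj]
  · gcongr
    · exact S.singularValues_nonneg _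
    · exact S.singularValues_antitone hj

/-! ### A variational inequality for sums of powers of singular values -/

/-- For `p ≥ 2` the sum `∑ ‖T vᵢ‖ ^ p` over an orthonormal family of length `k` is at most the sum
of the `p`-th powers of the first `k` singular values: in the basis of right singular vectors
`‖T vᵢ‖ ^ 2` is an average of the squared singular values, to which the convex function
`t ↦ t ^ (p / 2)` is applied. -/
theorem sum_norm_apply_rpow_le (T : E →ₗ[𝕜] F) {p : ℝ} (hp : 2 ≤ p) {k : ℕ} {v : Fin k → E}
    (hv : Orthonormal 𝕜 v) :
    ∑ i, ‖T (v i)‖ ^ p ≤ ∑ j ∈ Finset.range k, T.singularValues j ^ p := by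
  set b := T.rightSingularBasis
  have hσ := T.singularValues_nonneg
  have hkN : k ≤ finrank 𝕜 E := by
    simpa using hv.linearIndependent.fintype_card_le_finrank
  have hone (i) : ∑ j, ‖⟪b j, v i⟫_𝕜‖ ^ 2 = 1 := by
    rw [b.sum_sq_norm_inner_right, hv.norm_eq_one, one_pow]
  have hjensen (i) : ‖T (v i)‖ ^ p ≤
      ∑ j : Fin (finrank 𝕜 E), ‖⟪b j, v i⟫_𝕜‖ ^ 2 * T.singularValues j ^ p := by
    have h := Real.rpow_arith_mean_le_arith_mean_rpow Finset.univ
      (fun j => ‖⟪b j, v i⟫_𝕜‖ ^ 2) (fun j : Fin (finrank 𝕜 E) => T.singularValues j ^ 2)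
      (fun j _ => sq_nonneg _) (hone i) (fun j _ => sq_nonneg _) (p := p / 2) (by linarith)
    have heq : ∑ j : Fin (finrank 𝕜 E), ‖⟪b j, v i⟫_𝕜‖ ^ 2 * T.singularValues j ^ 2 =
        ‖T (v i)‖ ^ 2 := by
      rw [norm_apply_sq_eq_sum]
      exact Finset.sum_congr rfl fun j _ => mul_comm _ _
    rw [heq, Real.sq_rpow_div_two (norm_nonneg _)] at h
    simpa only [Real.sq_rpow_div_two (hσ _)] using h
  let w : ℕ → ℝ := fun j =>
    if hj : j < finrank 𝕜 E then ∑ i, ‖⟪b ⟨j, hj⟩, v i⟫_𝕜‖ ^ 2 else 0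
  have hw (j : Fin (finrank 𝕜 E)) : w j = ∑ i, ‖⟪b j, v i⟫_𝕜‖ ^ 2 := by simp [w]
  have hw0 (j) : 0 ≤ w j := by
    simp only [w]
    split_ifs
    · positivity
    · exact le_rfl
  -- Bessel's inequality for the family `v` bounds the weights by `1`.
  have hw1 (j) : w j ≤ 1 := by
    simp only [w]
    split_ifs with hj
    · have h := hv.sum_inner_products_le (b ⟨j, hj⟩) (s := Finset.univ)
      rw [b.norm_eq_one, one_pow] at h
      simpa only [norm_inner_symm] using h
    · exact zero_le_one
  have hwk : ∑ j ∈ Finset.range (finrank 𝕜 E), w j = k := by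
    rw [Finset.sum_range]
    simp only [hw]
    rw [Finset.sum_comm]
    simp [hone]
  have hanti : Antitone fun j => T.singularValues j ^ p := fun i j hij =>
    Real.rpow_le_rpow (hσ j) (T.singularValues_antitone hij) (by linarith)
  calc ∑ i, ‖T (v i)‖ ^ p
      ≤ ∑ i, ∑ j : Fin (finrank 𝕜 E), ‖⟪b j, v i⟫_𝕜‖ ^ 2 * T.singularValues j ^ p :=
        Finset.sum_le_sum fun i _ => hjensen i
    _ = ∑ j ∈ Finset.range (finrank 𝕜 E), w j * T.singularValues j ^ p := by
        rw [Finset.sum_comm, Finset.sum_range]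
        exact Finset.sum_congr rfl fun j _ => by rw [hw, Finset.sum_mul]
    _ ≤ _ := hanti.sum_mul_le_sum_range hkN hw0 hw1 hwk

/-! ### Rigidity of midpoints -/

/-- If neither endpoint of a segment has a larger sum of `p`-th powers of its first `k` singular
values than the midpoint `S`, then the endpoints agree with `S` on its first `k` right singular
vectors. -/
theorem apply_rightSingularBasis_eq_of_midpoint {T₀ T₁ S : E →ₗ[𝕜] F} (hS : T₀ + T₁ = S + S)
    {p : ℝ} (hp : 2 ≤ p) {k : ℕ} (hk : k ≤ finrank 𝕜 E)
    (h₀ : ∑ j ∈ Finset.range k, T₀.singularValues j ^ p ≤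
      ∑ j ∈ Finset.range k, S.singularValues j ^ p)
    (h₁ : ∑ j ∈ Finset.range k, T₁.singularValues j ^ p ≤
      ∑ j ∈ Finset.range k, S.singularValues j ^ p) (j : Fin k) :
    T₀ (S.rightSingularBasis (Fin.castLE hk j)) = S (S.rightSingularBasis (Fin.castLE hk j)) := by
  set v : Fin k → E := fun j => S.rightSingularBasis (Fin.castLE hk j) with hvdef
  have hv : Orthonormal 𝕜 v :=
    S.rightSingularBasis.orthonormal.comp _ (Fin.castLE_injective hk)
  have hq : 0 < p / 2 := by linarith
  have hpow (i) : (‖S (v i)‖ ^ 2) ^ (p / 2) = S.singularValues i ^ p := by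
    rw [Real.sq_rpow_div_two (norm_nonneg _), norm_apply_rightSingularBasis]
    rfl
  have hle (i) : (‖S (v i)‖ ^ 2) ^ (p / 2) ≤
      (‖S (v i)‖ ^ 2 + ‖T₀ (v i) - S (v i)‖ ^ 2) ^ (p / 2) :=
    Real.rpow_le_rpow (sq_nonneg _) (le_add_of_nonneg_right (sq_nonneg _)) hq.le
  have hge : ∑ i, (‖S (v i)‖ ^ 2 + ‖T₀ (v i) - S (v i)‖ ^ 2) ^ (p / 2) ≤
      ∑ i, (‖S (v i)‖ ^ 2) ^ (p / 2) := by
    calc _ ≤ ∑ i, (‖T₀ (v i)‖ ^ p + ‖T₁ (v i)‖ ^ p) / 2 :=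
          Finset.sum_le_sum fun i _ =>
            rpow_norm_sq_add_norm_sq_midpoint_le 𝕜 hp (LinearMap.congr_fun hS (v i))
      _ = (∑ i, ‖T₀ (v i)‖ ^ p + ∑ i, ‖T₁ (v i)‖ ^ p) / 2 := by
          rw [← Finset.sum_add_distrib, Finset.sum_div]
      _ ≤ ∑ j ∈ Finset.range k, S.singularValues j ^ p := by
          linarith [T₀.sum_norm_apply_rpow_le hp hv, T₁.sum_norm_apply_rpow_le hp hv]
      _ = _ := by simp only [Finset.sum_range, hpow]
  have heq := (Finset.sum_eq_sum_iff_of_le fun i _ => hle i).1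
    (le_antisymm (Finset.sum_le_sum fun i _ => hle i) hge) j (Finset.mem_univ j)
  have hzero := (Real.rpow_left_inj (sq_nonneg _) (by positivity) hq.ne').1 heq
  have : ‖T₀ (v j) - S (v j)‖ = 0 := by
    rw [← sq_eq_zero_iff]
    linarith
  exact sub_eq_zero.1 (norm_eq_zero.1 this)

theorem singularValues_eq_of_midpoint {T₀ T₁ S : E →ₗ[𝕜] F} (hS : T₀ + T₁ = S + S)
    {p : ℝ} (hp : 2 ≤ p) {k : ℕ} (hk : k ≤ finrank 𝕜 E)
    (h₀ : ∑ j ∈ Finset.range k, T₀.singularValues j ^ p ≤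
      ∑ j ∈ Finset.range k, S.singularValues j ^ p)
    (h₁ : ∑ j ∈ Finset.range k, T₁.singularValues j ^ p ≤
      ∑ j ∈ Finset.range k, S.singularValues j ^ p) {i : ℕ} (hi : i < k) :
    T₀.singularValues i = S.singularValues i := by
  have hle : ∀ j ∈ Finset.range k, S.singularValues j ≤ T₀.singularValues j := fun j hj =>
    singularValues_le_of_eq_on_rightSingularBasis ((Finset.mem_range.1 hj).trans_le hk)
      fun l hl => apply_rightSingularBasis_eq_of_midpoint hS hp hk h₀ h₁
        ⟨l, hl.trans_lt (Finset.mem_range.1 hj)⟩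
  have hp0 : 0 < p := by linarith
  have hpow : ∀ j ∈ Finset.range k, S.singularValues j ^ p ≤ T₀.singularValues j ^ p :=
    fun j hj => Real.rpow_le_rpow (S.singularValues_nonneg j) (hle j hj) hp0.le
  have heq := (Finset.sum_eq_sum_iff_of_le hpow).1
    (le_antisymm (Finset.sum_le_sum hpow) h₀) i (Finset.mem_range.2 hi)
  exact ((Real.rpow_left_inj (S.singularValues_nonneg i) (T₀.singularValues_nonneg i)
    hp0.ne').1 heq).symm

end LinearMap

/-! ### Best approximation in the Ky Fan norm -/

namespace KyFanApprox

variable {m n : ℕ}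

theorem sum_rpow_le_of_kyFanNorm_le {p : ℝ} (hp : 0 < p) {k : ℕ}
    {X Y : Matrix (Fin m) (Fin n) ℂ} (h : kyFanNorm p k X ≤ kyFanNorm p k Y) :
    ∑ j ∈ Finset.range k, (Matrix.toEuclideanLin X).singularValues j ^ p ≤
      ∑ j ∈ Finset.range k, (Matrix.toEuclideanLin Y).singularValues j ^ p := by
  have hsum (Z : Matrix (Fin m) (Fin n) ℂ) : ∑ i ∈ Finset.Icc 1 k, singularValue Z i ^ p =
      ∑ j ∈ Finset.range k, (Matrix.toEuclideanLin Z).singularValues j ^ p := by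
    rw [Finset.range_eq_Ico, ← Finset.Ico_add_one_right_eq_Icc, Finset.sum_Ico_eq_sum_range,
      Finset.sum_Ico_eq_sum_range]
    refine Finset.sum_congr rfl fun j _ => ?_
    simp [singularValue]
  have hnonneg (Z : Matrix (Fin m) (Fin n) ℂ) :
      0 ≤ ∑ j ∈ Finset.range k, (Matrix.toEuclideanLin Z).singularValues j ^ p :=
    Finset.sum_nonneg fun j _ => Real.rpow_nonneg (LinearMap.singularValues_nonneg _ j) _
  rw [kyFanNorm, kyFanNorm, hsum, hsum] at h
  exact (Real.rpow_le_rpow_iff (hnonneg X) (hnonneg Y) (one_div_pos.2 hp)).1 h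

end KyFanApprox

theorem mainTheorem2 {m n : ℕ} (M : Submodule ℝ (Matrix (Fin m) (Fin n) ℂ))
    (A : Matrix (Fin m) (Fin n) ℂ) (p : ℝ) (hp : 2 ≤ p)
    (k : ℕ) (hk : 1 ≤ k) (hkn : k ≤ min m n)
    (R₀ : Matrix (Fin m) (Fin n) ℂ) (hR₀ : R₀ ∈ KyFanApprox.residuals p k M A)
    (hgap : KyFanApprox.singularValue R₀ (k + 1) < KyFanApprox.singularValue R₀ k) :
    ∀ R ∈ KyFanApprox.residuals p k M A, ∀ i : ℕ, 1 ≤ i → i ≤ k →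
      KyFanApprox.singularValue R₀ i = KyFanApprox.singularValue R i := by
  obtain ⟨B₀, ⟨hB₀, hmin₀⟩, rfl⟩ := hR₀
  rintro _ ⟨B, ⟨hB, hmin⟩, rfl⟩ i hi1 hik
  set X := (1 / 2 : ℝ) • (B₀ + B) with hX
  have hXM : X ∈ M := M.smul_mem _ (M.add_mem hB₀ hB)
  have hmid : (A - B₀) + (A - B) = (A - X) + (A - X) := by
    have : X + X = B₀ + B := by
      rw [hX, ← add_smul]
      norm_num
    rw [sub_add_sub_comm, sub_add_sub_comm, this]
  have hlin : Matrix.toEuclideanLin (A - B₀) + Matrix.toEuclideanLin (A - B) =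
      Matrix.toEuclideanLin (A - X) + Matrix.toEuclideanLin (A - X) := by
    rw [← map_add, ← map_add, hmid]
  have hdim : k ≤ finrank ℂ (EuclideanSpace ℂ (Fin n)) := by
    simpa using hkn.trans (min_le_right m n)
  have hp0 : 0 < p := by linarith
  have h₀ := KyFanApprox.sum_rpow_le_of_kyFanNorm_le hp0 (hmin₀ X hXM)
  have h₁ := KyFanApprox.sum_rpow_le_of_kyFanNorm_le hp0 (hmin X hXM)
  have hi : i - 1 < k := by omega
  exact (LinearMap.singularValues_eq_of_midpoint hlin hp hdim h₀ h₁ hi).trans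
    (LinearMap.singularValues_eq_of_midpoint ((add_comm _ _).trans hlin) hp hdim h₁ h₀ hi).symm
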